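/- Let $L\ge N\ge 2$ be integers and let $m>0$, $b>0$, $a>0$, $h\ge 0$ and $\theta$ be real numbers. Place $N$ point masses, each equal to $m$, at the vertices of a regular $N$-gon, $$q_k=\Big(\cos\tfrac{2\pi k}{N},\ \sin\tfrac{2\pi k}{N},\ 0\Big),\qquad 1\le k\le N,$$ and $L$ point masses, each equal to $bm$, at the vertices of a regular $L$-gon, $$\tilde q_l=\Big(a\cos\big(\tfrac{2\pi l}{L}+\theta\big),\ a\sin\big(\tfrac{2\pi l}{L}+\theta\big),\ h\Big),\qquad 1\le l\le L$$ (a regular $2$-gon is a pair of antipodal points). Let $P_k$ and $\tilde P_l$ be the positions of these $N+L$ bodies relative to their common centre of mass. Bodies with masses $m_i>0$ at positions $x_i\in\mathbb R^3$ with $\sum_i m_ix_i=0$ form a central configuration if the $x_i$ are pairwise distinct and there is $\lambda\in\mathbb R$ such that $$\sum_{j\ne i}\frac{m_jm_i}{|x_j-x_i|^3}(x_j-x_i)=-\lambda\, m_i\,x_i\qquad\text{for all } i.$$ If $P_1,\dots,P_N,\tilde P_1,\dots,\tilde P_L$ form a central configuration, then $N=L$, and moreover $\theta\equiv 0$ or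 $\theta\equiv \pi/N \pmod{2\pi/N}$. -/

import Mathlib

/-- Newtonian central configurations of finitely many bodies in `ℝ³`, with masses `m` and
positions `q`: the centre of mass is at the origin, no two bodies collide, and for some real
constant `lam` the equations
`∑_{j ≠ k} m_j m_k / |q_j - q_k|³ (q_j - q_k) = - lam m_k q_k` hold for all `k`. -/
def IsCentralConfiguration {ι : Type*} [Fintype ι] [DecidableEq ι] (m : ι → ℝ)
    (q : ι → EuclideanSpace ℝ (Fin 3)) : Prop :=
  ∑ i, m i • q i = 0 ∧
  (∀ j k, j ≠ k → q j ≠ q k) ∧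
  ∃ lam : ℝ, ∀ k, ∑ j ∈ Finset.univ.erase k,
    (m j * m k / ‖q j - q k‖ ^ 3) • (q j - q k) = -(lam * m k) • q k

/-- The masses of the `N + L` bodies: each of the `N` lower ones has mass `m`, each of the `L`
upper ones has mass `b m`. -/
def twoPolygonMass (N L : ℕ) (m b : ℝ) : Fin N ⊕ Fin L → ℝ
  | Sum.inl _ => m
  | Sum.inr _ => b * m

/-- The vertices of the two polygons: the lower regular `N`-gon is inscribed in the unit circle of
the plane `z = 0`; the upper regular `L`-gon is inscribed in the circle of radius `a` about the
`z`-axis in the plane `z = h` and is turned by the angle `θ`. -/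
noncomputable def twoPolygonVertex (N L : ℕ) (a h θ : ℝ) :
    Fin N ⊕ Fin L → EuclideanSpace ℝ (Fin 3)
  | Sum.inl k => !₂[Real.cos (2 * Real.pi * k / N), Real.sin (2 * Real.pi * k / N), 0]
  | Sum.inr l => !₂[a * Real.cos (2 * Real.pi * l / L + θ),
      a * Real.sin (2 * Real.pi * l / L + θ), h]

/-- The positions of the bodies relative to their centre of mass. -/
noncomputable def twoPolygonConfig (N L : ℕ) (m b a h θ : ℝ) :
    Fin N ⊕ Fin L → EuclideanSpace ℝ (Fin 3) :=
  fun i => twoPolygonVertex N L a h θ i -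
    Finset.univ.centerMass (twoPolygonMass N L m b) (twoPolygonVertex N L a h θ)

open Real Finset MeasureTheory Filter Topology

/-! A squared distance between vertices of the two polygons has the form `D - 2 a cos ψ`. Since `1 /
d ^ 3` is `4 / π` times the integral over `x > 0` of `1 / (x ^ 2 + d ^ 2) ^ 2`, and `x ^ 2 + d ^ 2 =
2 a (cosh u - cos ψ)` with `u` depending on `x` but not on `ψ`, the force exerted by a whole polygon
becomes an integral of sums over `ψ = φ + 2πk/n`. These sums have closed forms, obtained by
differentiating the logarithm of the product below, so signs can be read off the integrand.

For the tangential force the integrand is a positive multiple of `sin (n φ)`, so equilibrium forces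
`sin (n φ) = 0` (`sin_nat_mul_eq_zero_of_sum`). Applied to two adjacent vertices of each polygon
this gives `N ∣ 2 L` and `L ∣ 2 N`, hence `L = N` or `L = 2 N`, and it makes `θ` a multiple of `π /
N`. If `L = N` this is the claim.

If `L = 2 N`, adjacent upper vertices see the `N`-gon once aligned and once staggered, yet by
symmetry of their own polygon both must feel the same radial and vertical force from it. For `h > 0`
the vertical forces differ (`sum_inv_chord_pow_three_lt`). For `h = 0` and `a ≠ 1` the radial forces
differ (`sum_radial_ne`). For `h = 0` and `a = 1` two bodies collide. -/

/-! ### Product formula over a regular polygon -/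

/-- `∏ 2 (cosh u - cos (φ + 2πk/n)) = 2 (cosh (n u) - cos (n φ))`. -/
theorem prod_cosh_sub_cos {n : ℕ} (hn : 0 < n) (u φ : ℝ) :
    ∏ k ∈ range n, (2 * (cosh u - cos (φ + 2 * π * k / n))) =
      2 * (cosh (n * u) - cos (n * φ)) := by
  have hn0 : (n : ℂ) ≠ 0 := by exact_mod_cast hn.ne'
  have hζ := Complex.isPrimitiveRoot_exp n hn.ne'
  set ζ := Complex.exp (2 * π * Complex.I / n) with hζdef
  have key {ξ : ℂ} (hξ : IsPrimitiveRoot ξ n) (x y : ℂ) :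
      x ^ n - y ^ n = ∏ k ∈ range n, (x - ξ ^ k * y) := by
    simpa [Polynomial.eval_prod] using
      congrArg (Polynomial.eval x) (X_pow_sub_C_eq_prod hξ hn (rfl : y ^ n = y ^ n))
  apply Complex.ofReal_injective
  push_cast
  -- Each factor splits so that the last two pieces multiply over `k` to `x ^ n - y ^ n`, with `x =
  -- exp u` and `y = exp (± i φ)`.
  have h2 (v ψ : ℂ) : 2 * (Complex.cosh v - Complex.cos ψ) =
      Complex.exp (-v) * (Complex.exp v - Complex.exp (ψ * Complex.I)) *
        (Complex.exp v - Complex.exp (-(ψ * Complex.I))) := by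
    have e1 : Complex.exp (-v) * Complex.exp v = 1 := by rw [← Complex.exp_add]; simp
    have e2 : Complex.exp (ψ * Complex.I) * Complex.exp (-(ψ * Complex.I)) = 1 := by
      rw [← Complex.exp_add]; simp
    rw [Complex.cosh, Complex.cos, neg_mul]
    linear_combination (-Complex.exp v + Complex.exp (ψ * Complex.I) +
      Complex.exp (-(ψ * Complex.I))) * e1 - Complex.exp (-v) * e2
  simp_rw [h2, prod_mul_distrib]
  rw [prod_const, card_range, ← Complex.exp_nat_mul]
  have e1 : ∏ k ∈ range n, (Complex.exp u - Complex.exp ((φ + 2 * π * k / n) * Complex.I)) =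
      Complex.exp (n * u) - Complex.exp (n * φ * Complex.I) := by
    rw [Complex.exp_nat_mul, mul_assoc (n : ℂ), Complex.exp_nat_mul, key hζ]
    refine prod_congr rfl fun k _ => ?_
    rw [hζdef, ← Complex.exp_nat_mul, ← Complex.exp_add]
    congr 2
    ring
  have e2 : ∏ k ∈ range n, (Complex.exp u - Complex.exp (-((φ + 2 * π * k / n) * Complex.I))) =
      Complex.exp (n * u) - Complex.exp (-(n * φ * Complex.I)) := by
    rw [Complex.exp_nat_mul, mul_assoc (n : ℂ), ← mul_neg, Complex.exp_nat_mul, key hζ.inv]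
    refine prod_congr rfl fun k _ => ?_
    rw [hζdef, ← Complex.exp_neg, ← Complex.exp_nat_mul, ← Complex.exp_add]
    congr 2
    ring
  rw [e1, e2, mul_neg]

/-! ### Inverse powers of a distance as integrals -/

theorem hasDerivAt_one_div_sq_add_sq_antideriv {d : ℝ} (hd : 0 < d) (x : ℝ) :
    HasDerivAt (fun x => (x / (x ^ 2 + d ^ 2) + arctan (x / d) / d) / (2 * d ^ 2))
      (1 / (x ^ 2 + d ^ 2) ^ 2) x := by
  have hne : x ^ 2 + d ^ 2 ≠ 0 := by positivity
  have h1 : HasDerivAt (fun x : ℝ => x / (x ^ 2 + d ^ 2))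
      ((1 * (x ^ 2 + d ^ 2) - x * (2 * x)) / (x ^ 2 + d ^ 2) ^ 2) x := by
    refine (hasDerivAt_id x).fun_div ?_ hne
    simpa using (hasDerivAt_pow 2 x).add_const (d ^ 2)
  have h2 := ((hasDerivAt_id x).div_const d).arctan.div_const d
  refine ((h1.fun_add h2).div_const (2 * d ^ 2)).congr_deriv ?_
  have : 1 + (x / d) ^ 2 ≠ 0 := by positivity
  simp only [id]
  field_simp
  ring

theorem hasDerivAt_one_div_add_sq_antideriv {d : ℝ} (hd : 0 < d) (x : ℝ) :
    HasDerivAt (fun x => arctan (x / d) / d) (1 / (x ^ 2 + d ^ 2)) x := by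
  refine (((hasDerivAt_id x).div_const d).arctan.div_const d).congr_deriv ?_
  have : 1 + (x / d) ^ 2 ≠ 0 := by positivity
  simp only [id]
  field_simp
  ring

theorem tendsto_arctan_div {d : ℝ} (hd : 0 < d) :
    Tendsto (fun x : ℝ => arctan (x / d)) atTop (𝓝 (π / 2)) :=
  (tendsto_nhds_of_tendsto_nhdsWithin tendsto_arctan_atTop).comp
    (tendsto_id.atTop_div_const hd)

theorem tendsto_one_div_sq_add_sq_antideriv {d : ℝ} (hd : 0 < d) :
    Tendsto (fun x : ℝ => (x / (x ^ 2 + d ^ 2) + arctan (x / d) / d) / (2 * d ^ 2)) atTop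
      (𝓝 (π / 4 * (1 / d ^ 3))) := by
  have h0 : Tendsto (fun x : ℝ => x / (x ^ 2 + d ^ 2)) atTop (𝓝 0) := by
    refine squeeze_zero' (g := fun x : ℝ => x⁻¹) ?_ ?_ tendsto_inv_atTop_zero
    · filter_upwards [eventually_gt_atTop 0] with x hx
      positivity
    · filter_upwards [eventually_gt_atTop 0] with x hx
      rw [inv_eq_one_div, div_le_div_iff₀ (by positivity) hx]
      nlinarith [sq_nonneg d]
  convert (h0.add ((tendsto_arctan_div hd).div_const d)).div_const (2 * d ^ 2) using 2
  field_simp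
  ring

theorem integrableOn_one_div_sq_add_sq {d : ℝ} (hd : 0 < d) :
    IntegrableOn (fun x : ℝ => 1 / (x ^ 2 + d ^ 2) ^ 2) (Set.Ioi 0) :=
  integrableOn_Ioi_deriv_of_nonneg' (fun x _ => hasDerivAt_one_div_sq_add_sq_antideriv hd x)
    (fun x _ => by positivity) (tendsto_one_div_sq_add_sq_antideriv hd)

theorem integral_one_div_sq_add_sq {d : ℝ} (hd : 0 < d) :
    ∫ x in Set.Ioi (0 : ℝ), 1 / (x ^ 2 + d ^ 2) ^ 2 = π / 4 * (1 / d ^ 3) := by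
  rw [integral_Ioi_of_hasDerivAt_of_nonneg'
    (fun x _ => hasDerivAt_one_div_sq_add_sq_antideriv hd x)
    (fun x _ => by positivity) (tendsto_one_div_sq_add_sq_antideriv hd)]
  simp

theorem integrableOn_one_div_add_sq {d : ℝ} (hd : 0 < d) :
    IntegrableOn (fun x : ℝ => 1 / (x ^ 2 + d ^ 2)) (Set.Ioi 0) :=
  integrableOn_Ioi_deriv_of_nonneg' (fun x _ => hasDerivAt_one_div_add_sq_antideriv hd x)
    (fun x _ => by positivity) ((tendsto_arctan_div hd).div_const d)

theorem integral_one_div_add_sq {d : ℝ} (hd : 0 < d) :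
    ∫ x in Set.Ioi (0 : ℝ), 1 / (x ^ 2 + d ^ 2) = π / 2 * (1 / d) := by
  rw [integral_Ioi_of_hasDerivAt_of_nonneg'
    (fun x _ => hasDerivAt_one_div_add_sq_antideriv hd x)
    (fun x _ => by positivity) ((tendsto_arctan_div hd).div_const d)]
  simp
  ring

/-- A linear combination of functions which is positive on `(0, ∞)` has positive integral. -/
theorem sum_mul_integral_pos {ι : Type*} {s : Finset ι} {c : ι → ℝ} {f : ι → ℝ → ℝ}
    (hf : ∀ i ∈ s, IntegrableOn (f i) (Set.Ioi 0))
    (hpos : ∀ x > 0, 0 < ∑ i ∈ s, c i * f i x) :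
    0 < ∑ i ∈ s, c i * ∫ x in Set.Ioi (0 : ℝ), f i x := by
  have hint : ∀ i ∈ s, Integrable (fun x => c i * f i x) (volume.restrict (Set.Ioi 0)) :=
    fun i hi => (hf i hi).const_mul (c i)
  have : ∑ i ∈ s, c i * ∫ x in Set.Ioi (0 : ℝ), f i x =
      ∫ x in Set.Ioi (0 : ℝ), ∑ i ∈ s, c i * f i x := by
    rw [integral_finsetSum _ hint]
    exact sum_congr rfl fun i _ => (integral_const_mul _ _).symm
  rw [this, setIntegral_pos_iff_support_of_nonneg_ae]
  · have : Set.Ioi (0 : ℝ) ⊆ (Function.support fun x => ∑ i ∈ s, c i * f i x) ∩ Set.Ioi 0 :=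
      fun x hx => ⟨(hpos x hx).ne', hx⟩
    exact lt_of_lt_of_le (by simp) (measure_mono this)
  · filter_upwards [ae_restrict_mem measurableSet_Ioi] with x hx
    exact (hpos x hx).le
  · exact integrable_finsetSum _ hint

/-- Integrating over `x` turns each term into `π / 4 * (c i / d i ^ 3)`. This reduces force
inequalities to inequalities between rational expressions in `cosh u` and `cos ψ`. -/
theorem sum_div_pow_three_pos {ι : Type*} {s : Finset ι} {c d : ι → ℝ} (hd : ∀ i ∈ s, 0 < d i)
    (hpos : ∀ x > 0, 0 < ∑ i ∈ s, c i / (x ^ 2 + d i ^ 2) ^ 2) :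
    0 < ∑ i ∈ s, c i / d i ^ 3 := by
  have h := sum_mul_integral_pos (c := c) (fun i hi => integrableOn_one_div_sq_add_sq (hd i hi))
    (by simpa only [mul_one_div] using hpos)
  rw [sum_congr rfl fun i hi => by rw [integral_one_div_sq_add_sq (hd i hi), mul_left_comm,
    mul_one_div], ← mul_sum] at h
  exact pos_of_mul_pos_right h (by positivity)

theorem sum_div_pos {ι : Type*} {s : Finset ι} {c d : ι → ℝ} (hd : ∀ i ∈ s, 0 < d i)
    (hpos : ∀ x > 0, 0 < ∑ i ∈ s, c i / (x ^ 2 + d i ^ 2)) :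
    0 < ∑ i ∈ s, c i / d i := by
  have h := sum_mul_integral_pos (c := c) (fun i hi => integrableOn_one_div_add_sq (hd i hi))
    (by simpa only [mul_one_div] using hpos)
  rw [sum_congr rfl fun i hi => by rw [integral_one_div_add_sq (hd i hi), mul_left_comm,
    mul_one_div], ← mul_sum] at h
  exact pos_of_mul_pos_right h (by positivity)

/-! ### Closed forms by logarithmic differentiation -/

theorem cosh_sub_cos_pos {u : ℝ} (hu : 0 < u) (ψ : ℝ) : 0 < cosh u - cos ψ := by
  have := one_lt_cosh.2 hu.ne'
  linarith [cos_le_one ψ]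

theorem sum_log_cosh_sub_cos {n : ℕ} (hn : 0 < n) {u : ℝ} (hu : 0 < u) (φ : ℝ) :
    ∑ k ∈ range n, log (cosh u - cos (φ + 2 * π * k / n)) =
      log (cosh (n * u) - cos (n * φ)) + (log 2 - n * log 2) := by
  have hn' : (0 : ℝ) < n := by exact_mod_cast hn
  have h := congrArg log (prod_cosh_sub_cos hn u φ)
  rw [log_prod fun k _ => (mul_pos two_pos (cosh_sub_cos_pos hu _)).ne',
    sum_congr rfl fun k _ => log_mul two_ne_zero (cosh_sub_cos_pos hu _).ne',
    log_mul two_ne_zero (cosh_sub_cos_pos (mul_pos hn' hu) _).ne', sum_add_distrib] at h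
  simp only [sum_const, card_range, nsmul_eq_mul] at h
  linarith

theorem hasDerivAt_cosh_nat_mul (n : ℕ) (u : ℝ) :
    HasDerivAt (fun u : ℝ => cosh (n * u)) (n * sinh (n * u)) u := by
  simpa [mul_comm] using ((hasDerivAt_id u).const_mul (n : ℝ)).cosh

theorem hasDerivAt_sinh_nat_mul (n : ℕ) (u : ℝ) :
    HasDerivAt (fun u : ℝ => sinh (n * u)) (n * cosh (n * u)) u := by
  simpa [mul_comm] using ((hasDerivAt_id u).const_mul (n : ℝ)).sinh

/-- Two functions which agree on `(0, ∞)` have the same derivative there. -/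
theorem deriv_eq_of_eq_on_pos {f g : ℝ → ℝ} {f' g' u : ℝ} (hu : 0 < u)
    (hfg : ∀ v > 0, f v = g v) (hf : HasDerivAt f f' u) (hg : HasDerivAt g g' u) : f' = g' :=
  hf.unique (hg.congr_of_eventuallyEq
    (by filter_upwards [eventually_gt_nhds hu] with v hv using hfg v hv))

theorem sum_sinh_div {n : ℕ} (hn : 0 < n) {u : ℝ} (hu : 0 < u) (φ : ℝ) :
    ∑ k ∈ range n, sinh u / (cosh u - cos (φ + 2 * π * k / n)) =
      n * sinh (n * u) / (cosh (n * u) - cos (n * φ)) := by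
  have hn' : (0 : ℝ) < n := by exact_mod_cast hn
  refine deriv_eq_of_eq_on_pos hu (fun v hv => sum_log_cosh_sub_cos hn hv φ)
    (HasDerivAt.fun_sum fun k _ =>
      ((hasDerivAt_cosh u).sub_const _).log (cosh_sub_cos_pos hu _).ne') ?_
  exact (((hasDerivAt_cosh_nat_mul n u).sub_const _).log
    (cosh_sub_cos_pos (mul_pos hn' hu) _).ne').add_const _

theorem sum_sin_div {n : ℕ} (hn : 0 < n) {u : ℝ} (hu : 0 < u) (φ : ℝ) :
    ∑ k ∈ range n, sin (φ + 2 * π * k / n) / (cosh u - cos (φ + 2 * π * k / n)) =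
      n * sin (n * φ) / (cosh (n * u) - cos (n * φ)) := by
  have hn' : (0 : ℝ) < n := by exact_mod_cast hn
  have h1 : HasDerivAt (fun φ => ∑ k ∈ range n, log (cosh u - cos (φ + 2 * π * k / n)))
      (∑ k ∈ range n, sin (φ + 2 * π * k / n) / (cosh u - cos (φ + 2 * π * k / n))) φ := by
    refine HasDerivAt.fun_sum fun k _ => HasDerivAt.log ?_ (cosh_sub_cos_pos hu _).ne'
    simpa using (((hasDerivAt_id φ).add_const (2 * π * k / n)).cos).const_sub (cosh u)
  have h2 : HasDerivAt (fun φ => log (cosh (n * u) - cos (n * φ)) + (log 2 - n * log 2))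
      (n * sin (n * φ) / (cosh (n * u) - cos (n * φ))) φ := by
    have h3 : HasDerivAt (fun φ => cosh (n * u) - cos (n * φ)) (n * sin (n * φ)) φ := by
      simpa [mul_comm] using (((hasDerivAt_id φ).const_mul (n : ℝ)).cos).const_sub (cosh (n * u))
    exact (h3.log (cosh_sub_cos_pos (mul_pos hn' hu) _).ne').add_const _
  simp_rw [sum_log_cosh_sub_cos hn hu] at h1
  exact h1.unique h2

/-- Derivative of `sum_sin_div` in `u`. The right side has the sign of `sin (n φ)`, which decides
the tangential force. -/
theorem sum_sin_div_sq {n : ℕ} (hn : 0 < n) {u : ℝ} (hu : 0 < u) (φ : ℝ) :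
    ∑ k ∈ range n, sin (φ + 2 * π * k / n) / (cosh u - cos (φ + 2 * π * k / n)) ^ 2 =
      n ^ 2 * sinh (n * u) / (sinh u * (cosh (n * u) - cos (n * φ)) ^ 2) * sin (n * φ) := by
  have hn' : (0 : ℝ) < n := by exact_mod_cast hn
  have h := deriv_eq_of_eq_on_pos hu (fun v hv => sum_sin_div hn hv φ)
    (HasDerivAt.fun_sum fun k _ => (hasDerivAt_const u (sin (φ + 2 * π * k / n))).fun_div
      ((hasDerivAt_cosh u).sub_const _) (cosh_sub_cos_pos hu _).ne')
    ((hasDerivAt_const u _).fun_div ((hasDerivAt_cosh_nat_mul n u).sub_const _)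
      (cosh_sub_cos_pos (mul_pos hn' hu) _).ne')
  have hs := sinh_pos_iff.2 hu
  have hS := cosh_sub_cos_pos (mul_pos hn' hu) (n * φ)
  have h' : -sinh u * ∑ k ∈ range n,
      sin (φ + 2 * π * k / n) / (cosh u - cos (φ + 2 * π * k / n)) ^ 2 =
      -(n ^ 2 * sin (n * φ) * sinh (n * u)) / (cosh (n * u) - cos (n * φ)) ^ 2 := by
    rw [mul_sum]
    convert h using 1
    · exact sum_congr rfl fun k _ => by ring
    · ring
  field_simp at h' ⊢
  linarith

/-- Derivative of `sum_sinh_div` in `u`. It ties the sum of inverse squares to the sum of inverses.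
-/
theorem sum_cosh_div_sub {n : ℕ} (hn : 0 < n) {u : ℝ} (hu : 0 < u) (φ : ℝ) :
    cosh u * ∑ k ∈ range n, 1 / (cosh u - cos (φ + 2 * π * k / n)) -
      sinh u ^ 2 * ∑ k ∈ range n, 1 / (cosh u - cos (φ + 2 * π * k / n)) ^ 2 =
    n ^ 2 * (cosh (n * u) / (cosh (n * u) - cos (n * φ)) -
      sinh (n * u) ^ 2 / (cosh (n * u) - cos (n * φ)) ^ 2) := by
  have hn' : (0 : ℝ) < n := by exact_mod_cast hn
  have h := deriv_eq_of_eq_on_pos hu (fun v hv => sum_sinh_div hn hv φ)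
    (HasDerivAt.fun_sum fun k _ => (hasDerivAt_sinh u).fun_div
      ((hasDerivAt_cosh u).sub_const _) (cosh_sub_cos_pos hu _).ne')
    (((hasDerivAt_sinh_nat_mul n u).const_mul _).fun_div
      ((hasDerivAt_cosh_nat_mul n u).sub_const _) (cosh_sub_cos_pos (mul_pos hn' hu) _).ne')
  have hS := cosh_sub_cos_pos (mul_pos hn' hu) (n * φ)
  rw [mul_sum, mul_sum, ← sum_sub_distrib]
  convert h using 1
  · refine sum_congr rfl fun k _ => ?_
    have := cosh_sub_cos_pos hu (φ + 2 * π * k / n)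
    field_simp
  · field_simp

/-! ### Aligned against staggered polygon: the integrands -/

/-- This is `tanh (n u) ≤ n tanh u` without denominators. -/
theorem sinh_nat_mul_le (n : ℕ) {u : ℝ} (hu : 0 ≤ u) :
    sinh (n * u) * cosh u ≤ n * (sinh u * cosh (n * u)) := by
  induction n with
  | zero => simp
  | succ n ih =>
    have h1 : 0 ≤ sinh (n * u) := sinh_nonneg_iff.2 (by positivity)
    have h2 : 0 ≤ sinh u := sinh_nonneg_iff.2 hu
    have h3 := one_le_cosh u
    have e1 : ((n + 1 : ℕ) : ℝ) * u = n * u + u := by push_cast; ring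
    rw [e1, sinh_add, cosh_add]
    push_cast
    have h4 : 0 ≤ n * (sinh u * cosh (n * u)) * (cosh u - 1) :=
      mul_nonneg (by positivity) (by linarith)
    have h5 : 0 ≤ n * sinh u * (sinh (n * u) * sinh u) := by positivity
    have h6 := cosh_sq u
    have h7 : 0 ≤ sinh (n * u) * (cosh u - 1) := mul_nonneg h1 (by linarith)
    nlinarith

/-- The two difference sums between an aligned and a staggered regular `n`-gon. -/
theorem diff_sum_one_div {n : ℕ} (hn : 0 < n) {u : ℝ} (hu : 0 < u) {φ φ' : ℝ}
    (hφ : cos (n * φ) = 1) (hφ' : cos (n * φ') = -1) :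
    ∑ k ∈ range n, 1 / (cosh u - cos (φ + 2 * π * k / n)) -
      ∑ k ∈ range n, 1 / (cosh u - cos (φ' + 2 * π * k / n)) =
      2 * n / (sinh u * sinh (n * u)) := by
  have hn' : (0 : ℝ) < n := by exact_mod_cast hn
  have h1 := sum_sinh_div hn hu φ
  have h2 := sum_sinh_div hn hu φ'
  simp_rw [← mul_one_div (sinh u), ← mul_sum] at h1 h2
  have hs := sinh_pos_iff.2 hu
  have hS := sinh_pos_iff.2 (mul_pos hn' hu)
  have hC := one_lt_cosh.2 (mul_pos hn' hu).ne'
  have hsq := cosh_sq (n * u)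
  rw [hφ] at h1
  rw [hφ'] at h2
  have hC1 : cosh (n * u) - 1 ≠ 0 := by linarith
  have hC2 : cosh (n * u) - -1 ≠ 0 := by linarith
  have e : n * sinh (n * u) / (cosh (n * u) - 1) - n * sinh (n * u) / (cosh (n * u) - -1) =
      2 * n / sinh (n * u) := by
    field_simp
    linear_combination -2 * hsq
  rw [← h1, ← h2, ← mul_sub] at e
  rw [← div_div, div_right_comm, ← e]
  field_simp

/-- Subtracting `sum_cosh_div_sub` at the two phases expresses the right side through the difference
of inverses. What remains is `sinh_nat_mul_le`. The factor 2 is what the radial comparison for `a <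
1` needs. -/
theorem diff_sum_one_div_sq {n : ℕ} (hn : 0 < n) {u : ℝ} (hu : 0 < u) {φ φ' : ℝ}
    (hφ : cos (n * φ) = 1) (hφ' : cos (n * φ') = -1) :
    2 * cosh u * (∑ k ∈ range n, 1 / (cosh u - cos (φ + 2 * π * k / n)) -
      ∑ k ∈ range n, 1 / (cosh u - cos (φ' + 2 * π * k / n))) ≤
    sinh u ^ 2 * (∑ k ∈ range n, 1 / (cosh u - cos (φ + 2 * π * k / n)) ^ 2 -
      ∑ k ∈ range n, 1 / (cosh u - cos (φ' + 2 * π * k / n)) ^ 2) := by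
  have hn' : (0 : ℝ) < n := by exact_mod_cast hn
  have hF := diff_sum_one_div hn hu hφ hφ'
  have h1 := sum_cosh_div_sub hn hu φ
  have h2 := sum_cosh_div_sub hn hu φ'
  have hs := sinh_pos_iff.2 hu
  have hS := sinh_pos_iff.2 (mul_pos hn' hu)
  have hC := one_lt_cosh.2 (mul_pos hn' hu).ne'
  have hsq := cosh_sq (n * u)
  rw [hφ] at h1
  rw [hφ'] at h2
  have hC1 : cosh (n * u) - 1 ≠ 0 := by linarith
  have hC2 : cosh (n * u) - -1 ≠ 0 := by linarith
  have e : n ^ 2 * (cosh (n * u) / (cosh (n * u) - 1) -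
        sinh (n * u) ^ 2 / (cosh (n * u) - 1) ^ 2) -
      n ^ 2 * (cosh (n * u) / (cosh (n * u) - -1) -
        sinh (n * u) ^ 2 / (cosh (n * u) - -1) ^ 2) =
      -(2 * n ^ 2 * cosh (n * u) / sinh (n * u) ^ 2) := by
    have h3 : sinh (n * u) ^ 2 = (cosh (n * u) - 1) * (cosh (n * u) - -1) := by
      linear_combination -hsq
    rw [h3]
    field_simp
    ring
  rw [← h1, ← h2] at e
  have h4 : cosh u * (2 * n / (sinh u * sinh (n * u))) ≤
      2 * n ^ 2 * cosh (n * u) / sinh (n * u) ^ 2 := by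
    rw [← mul_div_assoc, div_le_div_iff₀ (by positivity) (by positivity)]
    have := mul_le_mul_of_nonneg_left (sinh_nat_mul_le n hu.le)
      (by positivity : 0 ≤ 2 * n * sinh (n * u))
    nlinarith
  rw [← hF] at h4
  linarith

/-! ### Inequalities between polygon force sums -/

theorem sum_div_pow_three_lt {ι : Type*} {s : Finset ι} {c d c' d' : ι → ℝ}
    (hd : ∀ i ∈ s, 0 < d i) (hd' : ∀ i ∈ s, 0 < d' i)
    (h : ∀ x > 0, ∑ i ∈ s, c' i / (x ^ 2 + d' i ^ 2) ^ 2 < ∑ i ∈ s, c i / (x ^ 2 + d i ^ 2) ^ 2) :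
    ∑ i ∈ s, c' i / d' i ^ 3 < ∑ i ∈ s, c i / d i ^ 3 := by
  -- The difference of the two sums is a single sum over two copies of `s`, with the coefficients
  -- negated on the second.
  have := sum_div_pow_three_pos (s := s.disjSum s) (c := Sum.elim c (-c')) (d := Sum.elim d d')
    (by rintro (i | i) hi <;> simp_all)
    (fun x hx => by simpa [sum_disjSum, neg_div] using h x hx)
  simpa [sum_disjSum, neg_div] using this

theorem sum_div_lt {ι : Type*} {s : Finset ι} {c d c' d' : ι → ℝ}
    (hd : ∀ i ∈ s, 0 < d i) (hd' : ∀ i ∈ s, 0 < d' i)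
    (h : ∀ x > 0, ∑ i ∈ s, c' i / (x ^ 2 + d' i ^ 2) < ∑ i ∈ s, c i / (x ^ 2 + d i ^ 2)) :
    ∑ i ∈ s, c' i / d' i < ∑ i ∈ s, c i / d i := by
  have := sum_div_pos (s := s.disjSum s) (c := Sum.elim c (-c')) (d := Sum.elim d d')
    (by rintro (i | i) hi <;> simp_all)
    (fun x hx => by simpa [sum_disjSum, neg_div] using h x hx)
  simpa [sum_disjSum, neg_div] using this

/-- The distance between two points whose angles differ by `ψ`, where `D` is the sum of the squared
radii and the squared difference of heights, and `a` is the product of the radii. -/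
noncomputable def chord (D a ψ : ℝ) : ℝ := √(D - 2 * a * cos ψ)

theorem sub_mul_cos_nonneg {D a : ℝ} (ha : 0 < a) (hD : 2 * a ≤ D) (ψ : ℝ) :
    0 ≤ D - 2 * a * cos ψ := by
  nlinarith [cos_le_one ψ]

theorem chord_pos {D a : ℝ} (ha : 0 < a) (hD : 2 * a < D) (ψ : ℝ) : 0 < chord D a ψ :=
  sqrt_pos.2 (by nlinarith [cos_le_one ψ])

theorem chord_sq {D a : ℝ} (ha : 0 < a) (hD : 2 * a ≤ D) (ψ : ℝ) :
    chord D a ψ ^ 2 = D - 2 * a * cos ψ :=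
  sq_sqrt (sub_mul_cos_nonneg ha hD ψ)

/-- One `u` serves all angles `ψ`, so the closed forms apply to the whole polygon at each fixed `x`.
-/
theorem exists_sq_add_chord_sq {D a x : ℝ} (ha : 0 < a) (hD : 2 * a ≤ D) (hx : 0 < x) :
    ∃ u > 0, x ^ 2 + D = 2 * a * cosh u ∧
      ∀ ψ, x ^ 2 + chord D a ψ ^ 2 = 2 * a * (cosh u - cos ψ) := by
  have h1 : 1 < (x ^ 2 + D) / (2 * a) := by
    rw [one_lt_div (by positivity)]
    nlinarith
  have h2 : x ^ 2 + D = 2 * a * cosh (arcosh ((x ^ 2 + D) / (2 * a))) := by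
    rw [cosh_arcosh h1.le]
    field_simp
  refine ⟨_, arcosh_pos h1, h2, fun ψ => ?_⟩
  rw [chord_sq ha hD]
  linarith

/-- If `sin (n φ) ≠ 0`, then `sin (n φ)` times the sum has a positive integrand, proportional to
`sin (n φ) ^ 2`. Equality `D = 2 a` is allowed because equal coplanar circles (`a = 1`, `h = 0`)
must be covered. -/
theorem sin_nat_mul_eq_zero_of_sum {n : ℕ} (hn : 0 < n) {a D φ : ℝ} (ha : 0 < a) (hD : 2 * a ≤ D)
    (hpos : ∀ k ∈ range n, 0 < chord D a (φ + 2 * π * k / n))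
    (h : ∑ k ∈ range n, sin (φ + 2 * π * k / n) / chord D a (φ + 2 * π * k / n) ^ 3 = 0) :
    sin (n * φ) = 0 := by
  by_contra hne
  have hn' : (0 : ℝ) < n := by exact_mod_cast hn
  have key := sum_div_pow_three_pos (s := range n)
    (c := fun k => sin (n * φ) * sin (φ + 2 * π * k / n)) hpos (fun x hx => by
      obtain ⟨u, hu, -, hc⟩ := exists_sq_add_chord_sq ha hD hx
      have hs := sinh_pos_iff.2 hu
      have hS := sinh_pos_iff.2 (mul_pos hn' hu)
      have hC := cosh_sub_cos_pos (mul_pos hn' hu) (n * φ)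
      have h2 : 0 < sin (n * φ) ^ 2 := by positivity
      have : 0 < sin (n * φ) * (n ^ 2 * sinh (n * u) /
          (sinh u * (cosh (n * u) - cos (n * φ)) ^ 2) * sin (n * φ)) / (2 * a) ^ 2 := by
        rw [mul_left_comm, ← sq]
        positivity
      rw [← sum_sin_div_sq hn hu, mul_sum, sum_div] at this
      refine this.trans_eq (sum_congr rfl fun k _ => ?_)
      rw [hc, mul_pow _ (_ - _), mul_div_assoc', div_div, mul_comm (_ ^ 2) ((2 * a) ^ 2)])
  simp_rw [mul_div_assoc (sin (n * φ)), ← mul_sum] at key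
  rw [h, mul_zero] at key
  exact key.false

theorem diff_sum_pos {n : ℕ} (hn : 0 < n) {u φ φ' : ℝ} (hu : 0 < u)
    (hφ : cos (n * φ) = 1) (hφ' : cos (n * φ') = -1) :
    0 < ∑ k ∈ range n, 1 / (cosh u - cos (φ + 2 * π * k / n)) -
      ∑ k ∈ range n, 1 / (cosh u - cos (φ' + 2 * π * k / n)) := by
  have hn' : (0 : ℝ) < n := by exact_mod_cast hn
  have hs := sinh_pos_iff.2 hu
  have hS := sinh_pos_iff.2 (mul_pos hn' hu)
  rw [diff_sum_one_div hn hu hφ hφ']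
  positivity

theorem diff_sum_sq_pos {n : ℕ} (hn : 0 < n) {u φ φ' : ℝ} (hu : 0 < u)
    (hφ : cos (n * φ) = 1) (hφ' : cos (n * φ') = -1) :
    0 < ∑ k ∈ range n, 1 / (cosh u - cos (φ + 2 * π * k / n)) ^ 2 -
      ∑ k ∈ range n, 1 / (cosh u - cos (φ' + 2 * π * k / n)) ^ 2 := by
  have hs := sinh_pos_iff.2 hu
  have h1 := diff_sum_pos hn hu hφ hφ'
  have h2 := diff_sum_one_div_sq hn hu hφ hφ'
  have h3 := cosh_pos u
  exact pos_of_mul_pos_right ((mul_pos (by positivity) h1).trans_le h2) (by positivity)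

theorem sum_inv_chord_pow_three_lt {n : ℕ} (hn : 0 < n) {a D φ φ' : ℝ} (ha : 0 < a)
    (hD : 2 * a < D) (hφ : cos (n * φ) = 1) (hφ' : cos (n * φ') = -1) :
    ∑ k ∈ range n, 1 / chord D a (φ' + 2 * π * k / n) ^ 3 <
      ∑ k ∈ range n, 1 / chord D a (φ + 2 * π * k / n) ^ 3 := by
  refine sum_div_pow_three_lt (fun _ _ => chord_pos ha hD _) (fun _ _ => chord_pos ha hD _)
    fun x hx => ?_
  obtain ⟨u, hu, -, hc⟩ := exists_sq_add_chord_sq ha hD.le hx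
  have := sub_pos.1 (diff_sum_sq_pos hn hu hφ hφ')
  simp_rw [hc, mul_pow, ← one_div_mul_one_div, ← mul_sum]
  exact mul_lt_mul_of_pos_left this (by positivity)

theorem sum_inv_chord_lt {n : ℕ} (hn : 0 < n) {a D φ φ' : ℝ} (ha : 0 < a)
    (hD : 2 * a < D) (hφ : cos (n * φ) = 1) (hφ' : cos (n * φ') = -1) :
    ∑ k ∈ range n, 1 / chord D a (φ' + 2 * π * k / n) <
      ∑ k ∈ range n, 1 / chord D a (φ + 2 * π * k / n) := by
  refine sum_div_lt (fun _ _ => chord_pos ha hD _) (fun _ _ => chord_pos ha hD _)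
    fun x hx => ?_
  obtain ⟨u, hu, -, hc⟩ := exists_sq_add_chord_sq ha hD.le hx
  have := sub_pos.1 (diff_sum_pos hn hu hφ hφ')
  simp_rw [hc, ← one_div_mul_one_div, ← mul_sum]
  exact mul_lt_mul_of_pos_left this (by positivity)

theorem sum_radial_lt_of_lt_one {n : ℕ} (hn : 0 < n) {a φ φ' : ℝ} (ha : 0 < a) (ha1 : a < 1)
    (hφ : cos (n * φ) = 1) (hφ' : cos (n * φ') = -1) :
    ∑ k ∈ range n, (cos (φ' + 2 * π * k / n) - a) / chord (1 + a ^ 2) a (φ' + 2 * π * k / n) ^ 3 <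
      ∑ k ∈ range n, (cos (φ + 2 * π * k / n) - a) /
        chord (1 + a ^ 2) a (φ + 2 * π * k / n) ^ 3 := by
  have hD : 2 * a < 1 + a ^ 2 := by nlinarith [sq_pos_of_pos (sub_pos.2 ha1)]
  refine sum_div_pow_three_lt (fun _ _ => chord_pos ha hD _) (fun _ _ => chord_pos ha hD _)
    fun x hx => ?_
  obtain ⟨u, hu, -, hc⟩ := exists_sq_add_chord_sq ha hD.le hx
  have hG := diff_sum_sq_pos hn hu hφ hφ'
  have hFG := diff_sum_one_div_sq hn hu hφ hφ'
  have e (ψ : ℝ) : ∑ k ∈ range n, (cos (ψ + 2 * π * k / n) - a) /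
      (x ^ 2 + chord (1 + a ^ 2) a (ψ + 2 * π * k / n) ^ 2) ^ 2 =
      1 / (2 * a) ^ 2 * ((cosh u - a) * ∑ k ∈ range n, 1 / (cosh u - cos (ψ + 2 * π * k / n)) ^ 2 -
        ∑ k ∈ range n, 1 / (cosh u - cos (ψ + 2 * π * k / n))) := by
    rw [mul_sum, ← sum_sub_distrib, mul_sum]
    refine sum_congr rfl fun k _ => ?_
    have := cosh_sub_cos_pos hu (ψ + 2 * π * k / n)
    rw [hc]
    field_simp
    ring
  rw [e, e]
  refine mul_lt_mul_of_pos_left ?_ (by positivity)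
  set G := ∑ k ∈ range n, 1 / (cosh u - cos (φ + 2 * π * k / n)) ^ 2
  set G' := ∑ k ∈ range n, 1 / (cosh u - cos (φ' + 2 * π * k / n)) ^ 2
  set F := ∑ k ∈ range n, 1 / (cosh u - cos (φ + 2 * π * k / n))
  set F' := ∑ k ∈ range n, 1 / (cosh u - cos (φ' + 2 * π * k / n))
  have hcosh := cosh_pos u
  -- The difference of the two sides is `(cosh u - a) ^ 2 + 1 - a ^ 2`; here `a < 1` enters.
  have h1 : sinh u ^ 2 < 2 * cosh u * (cosh u - a) := by
    nlinarith [cosh_sq u, sq_nonneg (cosh u - a)]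
  have h2 : 2 * cosh u * (F - F') < 2 * cosh u * ((cosh u - a) * (G - G')) :=
    hFG.trans_lt ((mul_lt_mul_of_pos_right h1 hG).trans_eq (by ring))
  linarith [lt_of_mul_lt_mul_left h2 (by positivity)]

/-- From `2 a (cos ψ - a) = (1 - a ^ 2) - d ^ 2`, the sum is a combination of those of `1 / d ^ 3`
and `1 / d`. For `a > 1` both coefficients are negative, and both sums are larger in the aligned
position. -/
theorem sum_radial_gt_of_one_lt {n : ℕ} (hn : 0 < n) {a φ φ' : ℝ} (ha1 : 1 < a)
    (hφ : cos (n * φ) = 1) (hφ' : cos (n * φ') = -1) :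
    ∑ k ∈ range n, (cos (φ + 2 * π * k / n) - a) / chord (1 + a ^ 2) a (φ + 2 * π * k / n) ^ 3 <
      ∑ k ∈ range n, (cos (φ' + 2 * π * k / n) - a) /
        chord (1 + a ^ 2) a (φ' + 2 * π * k / n) ^ 3 := by
  have ha : 0 < a := by linarith
  have hD : 2 * a < 1 + a ^ 2 := by nlinarith [sq_pos_of_pos (sub_pos.2 ha1)]
  have h3 := sum_inv_chord_pow_three_lt hn ha hD hφ hφ'
  have h1 := sum_inv_chord_lt hn ha hD hφ hφ'
  have e (ψ : ℝ) : ∑ k ∈ range n, (cos (ψ + 2 * π * k / n) - a) /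
      chord (1 + a ^ 2) a (ψ + 2 * π * k / n) ^ 3 =
      1 / (2 * a) * ((1 - a ^ 2) * ∑ k ∈ range n, 1 / chord (1 + a ^ 2) a (ψ + 2 * π * k / n) ^ 3 -
        ∑ k ∈ range n, 1 / chord (1 + a ^ 2) a (ψ + 2 * π * k / n)) := by
    rw [mul_sum, ← sum_sub_distrib, mul_sum]
    refine sum_congr rfl fun k _ => ?_
    generalize ψ + 2 * π * k / n = α
    have h := chord_pos ha hD α
    have h2 := chord_sq ha hD.le α
    field_simp
    linear_combination h2
  rw [e, e]
  refine mul_lt_mul_of_pos_left ?_ (by positivity)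
  nlinarith

theorem sum_radial_ne {n : ℕ} (hn : 0 < n) {a φ φ' : ℝ} (ha : 0 < a) (ha1 : a ≠ 1)
    (hφ : cos (n * φ) = 1) (hφ' : cos (n * φ') = -1) :
    ∑ k ∈ range n, (cos (φ + 2 * π * k / n) - a) / chord (1 + a ^ 2) a (φ + 2 * π * k / n) ^ 3 ≠
      ∑ k ∈ range n, (cos (φ' + 2 * π * k / n) - a) /
        chord (1 + a ^ 2) a (φ' + 2 * π * k / n) ^ 3 := by
  rcases ha1.lt_or_gt with h | h
  · exact (sum_radial_lt_of_lt_one hn ha h hφ hφ').ne'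
  · exact (sum_radial_gt_of_one_lt hn h hφ hφ').ne

/-! ### Symmetries of sums over a regular polygon -/

theorem sum_polygon_shift {n : ℕ} (hn : 0 < n) {g : ℝ → ℝ} (hg : Function.Periodic g (2 * π))
    (φ : ℝ) (j : ℕ) :
    ∑ k ∈ range n, g (φ - 2 * π * j / n + 2 * π * k / n) =
      ∑ k ∈ range n, g (φ + 2 * π * k / n) := by
  have hn' : (n : ℝ) ≠ 0 := by exact_mod_cast hn.ne'
  induction j with
  | zero => simp
  | succ j ih =>
    rw [← ih]
    have h1 := sum_range_succ' (fun k : ℕ => g (φ - 2 * π * (j + 1 : ℕ) / n + 2 * π * k / n)) n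
    rw [sum_range_succ] at h1
    have h2 : g (φ - 2 * π * (j + 1 : ℕ) / n + 2 * π * n / n) =
        g (φ - 2 * π * (j + 1 : ℕ) / n + 2 * π * (0 : ℕ) / n) := by
      rw [mul_div_cancel_right₀ _ hn', hg]
      simp
    rw [h2] at h1
    rw [add_right_cancel h1]
    refine sum_congr rfl fun k _ => congrArg g ?_
    push_cast
    ring

theorem sum_polygon_sub {n : ℕ} (hn : 0 < n) {g : ℝ → ℝ} (hg : Function.Periodic g (2 * π))
    (θ : ℝ) (j : Fin n) :
    ∑ k : Fin n, g (2 * π * k / n + θ - (2 * π * j / n + θ)) =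
      ∑ k ∈ range n, g (2 * π * k / n) := by
  rw [Fin.sum_univ_eq_sum_range fun k : ℕ => g (2 * π * k / n + θ - (2 * π * j / n + θ))]
  have := sum_polygon_shift hn hg 0 j
  simp only [zero_add] at this
  rw [← this]
  exact sum_congr rfl fun k _ => congrArg g (by ring)

theorem sum_polygon_odd {n : ℕ} (hn : 0 < n) {g : ℝ → ℝ} (hg : Function.Periodic g (2 * π))
    (hodd : ∀ x, g (-x) = -g x) : ∑ k ∈ range n, g (2 * π * k / n) = 0 := by
  have hn' : (n : ℝ) ≠ 0 := by exact_mod_cast hn.ne'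
  -- The reflection `k ↦ n - 1 - k` negates the angles up to a rotation by `n - 1` steps, which
  -- leaves the sum unchanged.
  have h1 := sum_polygon_shift hn hg 0 (n - 1)
  simp only [zero_add] at h1
  have h2 := sum_range_reflect (fun k : ℕ => g (2 * π * k / n)) n
  have h3 : ∑ k ∈ range n, g (2 * π * (n - 1 - k : ℕ) / n) =
      -∑ k ∈ range n, g (0 - 2 * π * (n - 1 : ℕ) / n + 2 * π * k / n) := by
    rw [← sum_neg_distrib]
    refine sum_congr rfl fun k hk => ?_
    rw [← hodd, Nat.cast_sub (Nat.le_sub_one_of_lt (mem_range.1 hk))]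
    exact congrArg g (by ring)
  simp only [zero_sub] at h1 h3
  linarith

theorem sum_cos_add_polygon {n : ℕ} (hn : 2 ≤ n) (θ : ℝ) :
    ∑ k : Fin n, cos (2 * π * k / n + θ) = 0 := by
  have hn' : (n : ℂ) ≠ 0 := by
    have : n ≠ 0 := by omega
    exact_mod_cast this
  rw [Fin.sum_univ_eq_sum_range fun k : ℕ => cos (2 * π * k / n + θ)]
  have h := (Complex.isPrimitiveRoot_exp n (by omega)).geom_sum_eq_zero (by omega)
  have h2 : ∑ k ∈ range n, Complex.exp ((2 * π * k / n + θ : ℝ) * Complex.I) = 0 := by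
    rw [← zero_mul (Complex.exp (θ * Complex.I)), ← h, sum_mul]
    refine sum_congr rfl fun k _ => ?_
    rw [← Complex.exp_nat_mul, ← Complex.exp_add]
    push_cast
    congr 1
    ring
  have h3 := congrArg Complex.re h2
  simpa only [Complex.re_sum, Complex.exp_ofReal_mul_I_re, Complex.zero_re] using h3

theorem sum_sin_add_polygon {n : ℕ} (hn : 2 ≤ n) (θ : ℝ) :
    ∑ k : Fin n, sin (2 * π * k / n + θ) = 0 := by
  rw [← neg_eq_zero, ← sum_cos_add_polygon hn (θ + π / 2), ← sum_neg_distrib]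
  refine sum_congr rfl fun k _ => ?_
  rw [← add_assoc, cos_add_pi_div_two]

theorem chord_periodic (D a : ℝ) : Function.Periodic (chord D a) (2 * π) :=
  fun x => by simp [chord]

theorem chord_neg (D a x : ℝ) : chord D a (-x) = chord D a x := by simp [chord]

/-! ### Cylindrical form of the equations -/

/-- The point with cylindrical coordinates `r`, `α`, `z`. -/
noncomputable def cylPoint (r α z : ℝ) : EuclideanSpace ℝ (Fin 3) := !₂[r * cos α, r * sin α, z]

theorem norm_cylPoint_sub (r α z r' α' z' : ℝ) :
    ‖cylPoint r' α' z' - cylPoint r α z‖ =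
      chord (r ^ 2 + r' ^ 2 + (z' - z) ^ 2) (r * r') (α' - α) := by
  rw [EuclideanSpace.norm_eq, chord, cos_sub]
  congr 1
  simp only [cylPoint, Fin.sum_univ_three, Real.norm_eq_abs, sq_abs]
  simp
  linear_combination r' ^ 2 * sin_sq_add_cos_sq α' + r ^ 2 * sin_sq_add_cos_sq α

/-- The equations of a central configuration in cylindrical coordinates. -/
theorem IsCentralConfiguration.cylindrical {ι : Type*} [Fintype ι] [DecidableEq ι] {m : ι → ℝ}
    (hm : ∀ i, 0 < m i) {r α z : ι → ℝ} {c : EuclideanSpace ℝ (Fin 3)} (hc0 : c 0 = 0)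
    (hc1 : c 1 = 0)
    (hcc : IsCentralConfiguration m fun i => cylPoint (r i) (α i) (z i) - c) :
    (∀ i j, i ≠ j → 0 < chord (r i ^ 2 + r j ^ 2 + (z j - z i) ^ 2) (r i * r j) (α j - α i)) ∧
    ∃ lam : ℝ, ∀ i,
      ∑ j, m j / chord (r i ^ 2 + r j ^ 2 + (z j - z i) ^ 2) (r i * r j) (α j - α i) ^ 3 *
        (r j * sin (α j - α i)) = 0 ∧
      ∑ j, m j / chord (r i ^ 2 + r j ^ 2 + (z j - z i) ^ 2) (r i * r j) (α j - α i) ^ 3 *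
        (r j * cos (α j - α i) - r i) = -lam * r i ∧
      ∑ j, m j / chord (r i ^ 2 + r j ^ 2 + (z j - z i) ^ 2) (r i * r j) (α j - α i) ^ 3 *
        (z j - z i) = -lam * (z i - c 2) := by
  obtain ⟨-, hne, lam, h⟩ := hcc
  refine ⟨fun i j hij => ?_, lam, fun i => ?_⟩
  · rw [← norm_cylPoint_sub, norm_pos_iff, sub_ne_zero]
    exact fun he => hne i j hij (by simp [he])
  have hi := h i
  simp only [sub_sub_sub_cancel_right, norm_cylPoint_sub] at hi
  -- The self-term can be restored: its vector `q i - q i` is zero, whatever its coefficient.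
  rw [sum_erase _ (by simp)] at hi
  set w : ι → ℝ := fun j =>
    m j / chord (r i ^ 2 + r j ^ 2 + (z j - z i) ^ 2) (r i * r j) (α j - α i) ^ 3 with hw
  have hcoord (t : Fin 3) : ∑ j, w j * (cylPoint (r j) (α j) (z j) t -
      cylPoint (r i) (α i) (z i) t) = -lam * (cylPoint (r i) (α i) (z i) t - c t) := by
    have ht := congrArg (fun v : EuclideanSpace ℝ (Fin 3) => v t) hi
    simp only [WithLp.ofLp_sum, Finset.sum_apply, PiLp.smul_apply, PiLp.sub_apply,
      smul_eq_mul] at ht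
    apply mul_left_cancel₀ (hm i).ne'
    rw [mul_sum]
    convert ht using 1
    · refine sum_congr rfl fun j _ => ?_
      rw [hw]
      ring
    · ring
  have h0 := hcoord 0
  have h1 := hcoord 1
  have h2 := hcoord 2
  simp only [cylPoint, hc0, hc1, PiLp.toLp_apply, Matrix.cons_val] at h0 h1 h2
  refine ⟨?_, ?_, h2⟩
  -- Projection onto the tangential direction at body `i`. The centre of mass lies on the axis, so
  -- the right side has no component there.
  · have : ∑ j, w j * (r j * sin (α j - α i)) =
        cos (α i) * ∑ j, w j * (r j * sin (α j) - r i * sin (α i)) -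
        sin (α i) * ∑ j, w j * (r j * cos (α j) - r i * cos (α i)) := by
      rw [mul_sum, mul_sum, ← sum_sub_distrib]
      refine sum_congr rfl fun j _ => ?_
      rw [sin_sub]
      ring
    rw [this, h0, h1]
    ring
  · have : ∑ j, w j * (r j * cos (α j - α i) - r i) =
        cos (α i) * ∑ j, w j * (r j * cos (α j) - r i * cos (α i)) +
        sin (α i) * ∑ j, w j * (r j * sin (α j) - r i * sin (α i)) := by
      rw [mul_sum, mul_sum, ← sum_add_distrib]
      refine sum_congr rfl fun j _ => ?_
      rw [cos_sub]
      linear_combination w j * r i * sin_sq_add_cos_sq (α i)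
    rw [this, h0, h1]
    linear_combination -lam * r i * sin_sq_add_cos_sq (α i)

/-! ### Forces between the two polygons -/

/-- The distances of the vertices of the two polygons from the axis. -/
def twoPolygonRadius (N L : ℕ) (a : ℝ) : Fin N ⊕ Fin L → ℝ :=
  Sum.elim (fun _ => 1) fun _ => a

/-- The polar angles of the vertices of the two polygons. -/
noncomputable def twoPolygonAngle (N L : ℕ) (θ : ℝ) : Fin N ⊕ Fin L → ℝ :=
  Sum.elim (fun k => 2 * π * k / N) fun l => 2 * π * l / L + θ

/-- The heights of the vertices of the two polygons. -/
def twoPolygonHeight (N L : ℕ) (h : ℝ) : Fin N ⊕ Fin L → ℝ :=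
  Sum.elim (fun _ => 0) fun _ => h

theorem twoPolygonVertex_eq (N L : ℕ) (a h θ : ℝ) (i : Fin N ⊕ Fin L) :
    twoPolygonVertex N L a h θ i = cylPoint (twoPolygonRadius N L a i)
      (twoPolygonAngle N L θ i) (twoPolygonHeight N L h i) := by
  rcases i with k | l <;>
    simp [twoPolygonVertex, cylPoint, twoPolygonRadius, twoPolygonAngle, twoPolygonHeight]

theorem centerMass_twoPolygonVertex {N L : ℕ} (hN : 2 ≤ N) (hL : 2 ≤ L) (m b a h θ : ℝ) :
    Finset.univ.centerMass (twoPolygonMass N L m b) (twoPolygonVertex N L a h θ) 0 = 0 ∧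
    Finset.univ.centerMass (twoPolygonMass N L m b) (twoPolygonVertex N L a h θ) 1 = 0 := by
  have hN0 := sum_cos_add_polygon hN 0
  have hN1 := sum_sin_add_polygon hN 0
  simp only [add_zero] at hN0 hN1
  have hL0 := sum_cos_add_polygon hL θ
  have hL1 := sum_sin_add_polygon hL θ
  constructor
  · simp [Finset.centerMass, Fintype.sum_sum_type, twoPolygonMass, twoPolygonVertex, ← mul_sum,
      hN0, hL0]
  · simp [Finset.centerMass, Fintype.sum_sum_type, twoPolygonMass, twoPolygonVertex, ← mul_sum,
      hN1, hL1]

/-- Tangential forces inside a regular polygon cancel. -/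
theorem sum_polygon_tangential {n : ℕ} (hn : 0 < n) (m D r s θ : ℝ) (j : Fin n) :
    ∑ k : Fin n, m / chord D s (2 * π * k / n + θ - (2 * π * j / n + θ)) ^ 3 *
      (r * sin (2 * π * k / n + θ - (2 * π * j / n + θ))) = 0 := by
  have hg : Function.Periodic (fun x => m / chord D s x ^ 3 * (r * sin x)) (2 * π) :=
    fun x => by simp only [chord_periodic D s x, sin_add_two_pi]
  rw [sum_polygon_sub hn hg]
  exact sum_polygon_odd hn hg fun x => by simp only [chord_neg, sin_neg]; ring

/-- The radial force inside a regular polygon is the same at all vertices. -/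
theorem sum_polygon_radial {n : ℕ} (hn : 0 < n) (m D r s θ : ℝ) (j : Fin n) :
    ∑ k : Fin n, m / chord D s (2 * π * k / n + θ - (2 * π * j / n + θ)) ^ 3 *
      (r * cos (2 * π * k / n + θ - (2 * π * j / n + θ)) - r) =
    ∑ k ∈ range n, m / chord D s (2 * π * k / n) ^ 3 * (r * cos (2 * π * k / n) - r) :=
  sum_polygon_sub hn (g := fun x => m / chord D s x ^ 3 * (r * cos x - r))
    (fun x => by simp only [chord_periodic D s x, cos_add_two_pi]) θ j

/-- The consequences of the central configuration equations for the forces between the two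
polygons. -/
theorem twoPolygon_equations {N L : ℕ} (hN : 2 ≤ N) (hL : 2 ≤ L) {m b a h θ : ℝ} (hm : 0 < m)
    (hb : 0 < b) (ha : 0 < a)
    (hcc : IsCentralConfiguration (twoPolygonMass N L m b) (twoPolygonConfig N L m b a h θ)) :
    (∀ (k : Fin N) (l : Fin L),
      0 < chord (1 + a ^ 2 + h ^ 2) a (2 * π * l / L + θ - 2 * π * k / N)) ∧
    (∀ k : Fin N, ∑ l ∈ range L, sin (θ - 2 * π * k / N + 2 * π * l / L) /
      chord (1 + a ^ 2 + h ^ 2) a (θ - 2 * π * k / N + 2 * π * l / L) ^ 3 = 0) ∧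
    (∀ l : Fin L, ∑ k ∈ range N, sin (-(2 * π * l / L + θ) + 2 * π * k / N) /
      chord (1 + a ^ 2 + h ^ 2) a (-(2 * π * l / L + θ) + 2 * π * k / N) ^ 3 = 0) ∧
    (∃ R : ℝ, ∀ l : Fin L, ∑ k ∈ range N, (cos (-(2 * π * l / L + θ) + 2 * π * k / N) - a) /
      chord (1 + a ^ 2 + h ^ 2) a (-(2 * π * l / L + θ) + 2 * π * k / N) ^ 3 = R) ∧
    (∃ V : ℝ, h ≠ 0 → ∀ l : Fin L, ∑ k ∈ range N,
      1 / chord (1 + a ^ 2 + h ^ 2) a (-(2 * π * l / L + θ) + 2 * π * k / N) ^ 3 = V) := by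
  have hmass : ∀ i, 0 < twoPolygonMass N L m b i := by
    rintro (k | l) <;> simp only [twoPolygonMass] <;> positivity
  obtain ⟨hc0, hc1⟩ := centerMass_twoPolygonVertex hN hL m b a h θ
  have hconfig : twoPolygonConfig N L m b a h θ = fun i => cylPoint (twoPolygonRadius N L a i)
      (twoPolygonAngle N L θ i) (twoPolygonHeight N L h i) -
        Finset.univ.centerMass (twoPolygonMass N L m b) (twoPolygonVertex N L a h θ) :=
    funext fun i => by rw [twoPolygonConfig, twoPolygonVertex_eq]
  rw [hconfig] at hcc
  obtain ⟨hpos, lam, heq⟩ := hcc.cylindrical hmass hc0 hc1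
  set cz := (Finset.univ.centerMass (twoPolygonMass N L m b) (twoPolygonVertex N L a h θ)) 2
  have hDN : 1 ^ 2 + a ^ 2 + (h - 0) ^ 2 = 1 + a ^ 2 + h ^ 2 := by ring
  have hDL : a ^ 2 + 1 ^ 2 + (0 - h) ^ 2 = 1 + a ^ 2 + h ^ 2 := by ring
  have heqN (k : Fin N) := heq (Sum.inl k)
  have heqL (l : Fin L) := heq (Sum.inr l)
  simp only [Fintype.sum_sum_type, twoPolygonMass, twoPolygonRadius, twoPolygonAngle,
    twoPolygonHeight, Sum.elim_inl, Sum.elim_inr, hDN, hDL, one_mul, mul_one] at heqN heqL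
  have hsN (f : ℝ → ℝ) (k : Fin N) : ∑ l : Fin L, f (2 * π * l / L + θ - 2 * π * k / N) =
      ∑ l ∈ range L, f (θ - 2 * π * k / N + 2 * π * l / L) := by
    rw [Fin.sum_univ_eq_sum_range fun l : ℕ => f (2 * π * l / L + θ - 2 * π * k / N)]
    exact sum_congr rfl fun l _ => congrArg f (by ring)
  have hsL (f : ℝ → ℝ) (l : Fin L) : ∑ k : Fin N, f (2 * π * k / N - (2 * π * l / L + θ)) =
      ∑ k ∈ range N, f (-(2 * π * l / L + θ) + 2 * π * k / N) := by
    rw [Fin.sum_univ_eq_sum_range fun k : ℕ => f (2 * π * k / N - (2 * π * l / L + θ))]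
    exact sum_congr rfl fun l _ => congrArg f (by ring)
  have e (x c : ℝ) : m / c ^ 3 * x = m * (x / c ^ 3) := by ring
  refine ⟨fun k l => ?_, fun k => ?_, fun l => ?_, ?_, ?_⟩
  · have := hpos (Sum.inl k) (Sum.inr l) (by simp)
    simpa only [twoPolygonRadius, twoPolygonAngle, twoPolygonHeight, Sum.elim_inl, Sum.elim_inr,
      hDN, one_mul] using this
  · have h1 := (heqN k).1
    have h2 := sum_polygon_tangential (by omega) m (1 ^ 2 + 1 ^ 2 + (0 - 0) ^ 2) 1 1 0 k
    simp only [add_zero, one_mul] at h2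
    rw [h2, zero_add, hsN (fun x => b * m / chord _ _ x ^ 3 * (a * sin x))] at h1
    have e (x c : ℝ) : b * m / c ^ 3 * (a * x) = b * m * a * (x / c ^ 3) := by ring
    simp only [e, ← mul_sum] at h1
    exact (mul_eq_zero.1 h1).resolve_left (by positivity)
  · have h1 := (heqL l).1
    rw [sum_polygon_tangential (by omega), add_zero,
      hsL (fun x => m / chord _ _ x ^ 3 * sin x)] at h1
    simp only [e, ← mul_sum] at h1
    exact (mul_eq_zero.1 h1).resolve_left hm.ne'
  -- The witness `R` is left to unification: it is `-lam * a` minus the radial force of the upper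
  -- polygon on itself, divided by `m`, and so is free of `l`.
  · refine ⟨?_, fun l => ?_⟩
    rotate_left
    · have h1 := (heqL l).2.1
      rw [sum_polygon_radial (by omega), hsL (fun x => m / chord _ _ x ^ 3 * (cos x - a))] at h1
      simp only [e, ← mul_sum] at h1
      exact (eq_div_of_mul_eq hm.ne' ((mul_comm _ _).trans (eq_sub_of_add_eq h1)))
  · refine ⟨-lam * (h - cz) / (m * -h), fun hh l => ?_⟩
    have h1 := (heqL l).2.2
    simp only [sub_self, mul_zero, sum_const_zero, add_zero] at h1
    rw [hsL (fun x => m / chord _ _ x ^ 3 * (0 - h)), ← sum_mul] at h1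
    rw [eq_div_iff (mul_ne_zero hm.ne' (neg_ne_zero.2 hh)), ← h1, zero_sub, ← mul_assoc, sum_mul]
    simp_rw [one_div_mul_eq_div]

/-! ### Arithmetic of the angles and exclusion of `L = 2 N` -/

theorem theorem1p6 (N L : ℕ) (hN : 2 ≤ N) (hNL : N ≤ L) (m b a h θ : ℝ)
    (hm : 0 < m) (hb : 0 < b) (ha : 0 < a) (hh : 0 ≤ h)
    (hcc : IsCentralConfiguration (twoPolygonMass N L m b) (twoPolygonConfig N L m b a h θ)) :
    N = L ∧ ∃ k : ℤ, θ = 2 * Real.pi * k / N ∨ θ = Real.pi / N + 2 * Real.pi * k / N := by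
  have hL : 2 ≤ L := hN.trans hNL
  have hN0 : (0 : ℝ) < N := by exact_mod_cast (by omega : 0 < N)
  have hL0 : (0 : ℝ) < L := by exact_mod_cast (by omega : 0 < L)
  obtain ⟨hpos, htN, htL, ⟨R, hR⟩, V, hV⟩ := twoPolygon_equations hN hL hm hb ha hcc
  have hD : 2 * a ≤ 1 + a ^ 2 + h ^ 2 := by nlinarith [sq_nonneg (a - 1), sq_nonneg h]
  have hsinN (k : Fin N) : sin (L * (θ - 2 * π * k / N)) = 0 :=
    sin_nat_mul_eq_zero_of_sum (by omega) ha hD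
      (fun l hl => (hpos k ⟨l, mem_range.1 hl⟩).trans_eq (congrArg _ (by simp only; ring)))
      (htN k)
  have hsinL (l : Fin L) : sin (N * -(2 * π * l / L + θ)) = 0 :=
    sin_nat_mul_eq_zero_of_sum (by omega) ha hD
      (fun k hk => (hpos ⟨k, mem_range.1 hk⟩ l).trans_eq
        ((chord_neg _ _ _).symm.trans (congrArg _ (by simp only; ring))))
      (htL l)
  obtain ⟨i, hi⟩ := sin_eq_zero_iff.1 (hsinN ⟨0, by omega⟩)
  obtain ⟨i', hi'⟩ := sin_eq_zero_iff.1 (hsinN ⟨1, by omega⟩)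
  obtain ⟨j, hj⟩ := sin_eq_zero_iff.1 (hsinL ⟨0, by omega⟩)
  obtain ⟨j', hj'⟩ := sin_eq_zero_iff.1 (hsinL ⟨1, by omega⟩)
  simp only [Nat.cast_zero, Nat.cast_one, mul_zero, mul_one, zero_div, sub_zero, zero_add]
    at hi hi' hj hj'
  have hp : (i - i') * (N : ℤ) = 2 * L := by
    have : ((i - i') * N : ℝ) * π = 2 * L * π := by
      field_simp at hi'
      linear_combination N * hi - hi'
    exact_mod_cast mul_right_cancel₀ pi_ne_zero this
  have hq : (j - j') * (L : ℤ) = 2 * N := by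
    have : ((j - j') * L : ℝ) * π = 2 * N * π := by
      field_simp at hj'
      linear_combination L * hj - hj'
    exact_mod_cast mul_right_cancel₀ pi_ne_zero this
  have hθ : θ = π * (-j : ℤ) / N := by
    rw [eq_div_iff hN0.ne']
    push_cast
    linarith
  have hNL' : L = N ∨ L = 2 * N := by
    generalize i - i' = p at hp
    generalize j - j' = q at hq
    -- Multiply `p N = 2 L` by `q L = 2 N`. With `N ≤ L`, only `p = 2` (`L = N`) and `p = 4` (`L = 2
    -- N`) survive.
    have hpq : p * q = 4 := by
      have : (p * q) * ((N : ℤ) * L) = 4 * (N * L) := by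
        linear_combination q * L * hp + 2 * L * hq
      exact mul_right_cancel₀ (by positivity) this
    have hp2 : 2 ≤ p := by nlinarith
    have hq1 : 1 ≤ q := by nlinarith
    have hp4 : p ≤ 4 := by nlinarith
    interval_cases p <;> omega
  rcases hNL' with rfl | hLN
  · refine ⟨rfl, ?_⟩
    rcases Int.even_or_odd' (-j) with ⟨k, hk | hk⟩
    · exact ⟨k, Or.inl (by rw [hθ, hk]; push_cast; ring)⟩
    · exact ⟨k, Or.inr (by rw [hθ, hk]; push_cast; ring)⟩
  · exfalso
    have hsq : cos (N * -θ) = 1 ∨ cos (N * -θ) = -1 := by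
      rw [← sin_eq_zero_iff_cos_eq, ← hj]
      exact sin_int_mul_pi j
    -- For `L = 2 N`, one step along the upper polygon changes `N` times the angle by `π`, swapping
    -- aligned and staggered.
    have hnext : cos (N * -(2 * π / L + θ)) = -cos (N * -θ) := by
      rw [← cos_sub_pi, hLN]
      congr 1
      push_cast
      field_simp
      ring
    have hdis : ∃ φ φ', cos (N * φ) = 1 ∧ cos (N * φ') = -1 ∧
        (∑ k ∈ range N, (cos (φ + 2 * π * k / N) - a) /
          chord (1 + a ^ 2 + h ^ 2) a (φ + 2 * π * k / N) ^ 3 =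
        ∑ k ∈ range N, (cos (φ' + 2 * π * k / N) - a) /
          chord (1 + a ^ 2 + h ^ 2) a (φ' + 2 * π * k / N) ^ 3) ∧
        (h ≠ 0 → ∑ k ∈ range N, 1 / chord (1 + a ^ 2 + h ^ 2) a (φ + 2 * π * k / N) ^ 3 =
          ∑ k ∈ range N, 1 / chord (1 + a ^ 2 + h ^ 2) a (φ' + 2 * π * k / N) ^ 3) := by
      have r0 := hR ⟨0, by omega⟩
      have r1 := hR ⟨1, by omega⟩
      have v (hne : h ≠ 0) := (hV hne ⟨0, by omega⟩).trans (hV hne ⟨1, by omega⟩).symm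
      simp only [Nat.cast_zero, Nat.cast_one, mul_zero, mul_one, zero_div, zero_add] at r0 r1 v
      rcases hsq with h1 | h1
      · exact ⟨_, _, h1, by rw [hnext, h1], r0.trans r1.symm, v⟩
      · exact ⟨_, _, by rw [hnext, h1, neg_neg], h1, r1.trans r0.symm, fun hne => (v hne).symm⟩
    obtain ⟨φ, φ', hφ, hφ', hrad, hvert⟩ := hdis
    have hnpos : 0 < N := by omega
    rcases hh.eq_or_lt with rfl | hh
    · have e : 1 + a ^ 2 + (0 : ℝ) ^ 2 = 1 + a ^ 2 := by ring
      rw [e] at hrad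
      refine sum_radial_ne hnpos ha (fun ha1 => ?_) hφ hφ' hrad
      have hl0 := Int.emod_nonneg j (by omega : (L : ℤ) ≠ 0)
      have hlL := Int.emod_lt_of_pos j (by omega : 0 < (L : ℤ))
      -- Since `θ = -π j / N = -2π j / L`, the upper vertex with index `j` modulo `L` has polar
      -- angle 0 modulo `2π`; with `a = 1` and `h = 0` it coincides with the lower vertex 0.
      have hp := hpos ⟨0, hnpos⟩ ⟨(j % L).toNat, by omega⟩
      have hcast : (((j % L).toNat : ℕ) : ℝ) = j - L * (j / L : ℤ) := by
        have h1 : (((j % L).toNat : ℕ) : ℤ) = j - L * (j / L) := by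
          rw [Int.toNat_of_nonneg hl0, Int.emod_def]
        exact_mod_cast congrArg (Int.cast : ℤ → ℝ) h1
      have hang : 2 * π * ((j % L).toNat : ℕ) / L + θ - 2 * π * (0 : ℕ) / N =
          (-(j / L) : ℤ) * (2 * π) := by
        have hLN' : (L : ℝ) = 2 * N := by exact_mod_cast hLN
        rw [hcast, hθ]
        push_cast
        generalize ((j / L : ℤ) : ℝ) = q
        rw [hLN']
        field_simp
        ring
      rw [hang, chord, cos_int_mul_two_pi, ha1] at hp
      norm_num at hp
    · exact (sum_inv_chord_pow_three_lt hnpos ha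
        (by nlinarith [sq_nonneg (a - 1), sq_pos_of_pos hh]) hφ hφ').ne' (hvert hh.ne')
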